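/- Let $\mathcal V$ be a finite set and $\mathcal G=(\mathcal V,\mathcal E)$, $\mathcal E\subseteq\mathcal V\times\mathcal V$, a directed graph with a self-loop $(i,i)\in\mathcal E$ at every node $i$. Let $W\in\mathbb R^{\mathcal V\times\mathcal V}$ be nonnegative and row-stochastic with $W_{ij}=0$ whenever $(i,j)\notin\mathcal E$, and put $\Lambda=I-\mathrm{diag}(W)$, $\lambda_i=\Lambda_{ii}=1-W_{ii}$ and $d_i=|\{j:(i,j)\in\mathcal E\}|$. Define $$h_i=\begin{cases}1-(1-\lambda_i)/d_i & \text{if } d_i\neq 1,\\ 0 & \text{otherwise,}\end{cases}\qquad \Gamma_{ij}=\begin{cases}\dfrac{d_i(1-h_i)+h_i-(1-\lambda_iW_{ii})}{h_i} & \text{if } i=j,\ d_i\ne1,\\[4pt] \dfrac{\lambda_iW_{ij}}{h_i} & \text{if } i\neq j,\ d_i\neq1,\\ 1 & \text{if } i=j,\ d_i=1,\\ 0 & \text{if } i\neq j,\ d_i=1.\end{cases}$$ Let $v\in\mathbb R^{\mathcal V}$ and $x(0)=v$. At each time $k\ge0$ an edge $\theta(k)$ is drawn uniformly from $\mathcal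 E$, independently over time; if $\theta(k)=(i,j)$, then $$x_i(k+1)=h_i\big((1-\Gamma_{ij})x_i(k)+\Gamma_{ij}x_j(k)\big)+(1-h_i)v_i,\qquad x_\ell(k+1)=x_\ell(k)\ \text{ for } \ell\neq i.$$ Assume that in the graph associated to $W$ (whose edges are the pairs $(i,j)$ with $W_{ij}>0$) there is, from every node $\ell$, a path to some node $i$ with $W_{ii}>0$. Then $I-\Lambda W$ is invertible and, with $\bar x(k)=\frac1k\sum_{\ell=0}^{k-1}x(\ell)$: 1. the process $x$ is almost surely ergodic: there is an integrable random vector $x_\infty$ such that $\lim_{k\to\infty}\bar x(k)=\mathbb E[x_\infty]$ almost surely; 2. the process $x$ is mean-square ergodic: there is an integrable random vector $x_\infty$ such that $\lim_{k\to\infty}\mathbb E\big[\|\bar x(k)-\mathbb E[x_\infty]\|_2^2\big]=0$, all these expectations being finite; 3. the time-averaged opinions $\bar x(k)$ converge, both almost surely and in mean square, to $(I-\Lambda W)^{-1}(I-\Lambda)v$. -/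

import Mathlib

open MeasureTheory ProbabilityTheory Filter Topology
open scoped Matrix

namespace GossipOpinion

section Graphs

variable {V : Type*}

/-- There is a directed path (a finite chain of edges) from `i` to `j` in the graph with edge set
`E`. The chain may be empty. -/
def HasPath (E : Set (V × V)) (i j : V) : Prop :=
  Relation.ReflTransGen (fun a b => (a, b) ∈ E) i j

/-- The edge set of the graph associated to a nonnegative matrix: `(i, j)` is an edge if and only
if the entry `i j` is positive. -/
def assocEdges (W : Matrix V V ℝ) : Set (V × V) := {e | 0 < W e.1 e.2}

/-- The number `d i` of edges that leave `i` (self-loops are counted). -/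
def outDegree [Fintype V] [DecidableEq V] (E : Finset (V × V)) (i : V) : ℕ :=
  (Finset.univ.filter (fun j : V => (i, j) ∈ E)).card

end Graphs

noncomputable section Dynamics

variable {V : Type*} [Fintype V] [DecidableEq V]

/-- The diagonal sensitivity matrix `Λ = I - diag(W)`. -/
def sensitivity (W : Matrix V V ℝ) : Matrix V V ℝ := 1 - Matrix.diagonal (fun i => W i i)

/-- The limit opinion profile `(I - Λ W)⁻¹ (I - Λ) v`. -/
def limitOpinion (W : Matrix V V ℝ) (v : V → ℝ) : V → ℝ :=
  (1 - sensitivity W * W)⁻¹ *ᵥ ((1 - sensitivity W) *ᵥ v)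

/-- The coefficients `h i`. -/
def obstinacy (E : Finset (V × V)) (W : Matrix V V ℝ) (i : V) : ℝ :=
  if outDegree E i ≠ 1 then 1 - (1 - sensitivity W i i) / (outDegree E i : ℝ) else 0

/-- The coefficients `Γ i j`. -/
def gossipWeight (E : Finset (V × V)) (W : Matrix V V ℝ) (i j : V) : ℝ :=
  if outDegree E i ≠ 1 then
    if i = j then
      ((outDegree E i : ℝ) * (1 - obstinacy E W i) + obstinacy E W i
        - (1 - sensitivity W i i * W i i)) / obstinacy E W i
    else sensitivity W i i * W i j / obstinacy E W i
  else if i = j then 1 else 0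

/-- One gossip update along the edge `e = (i, j)`: only the opinion of `i` changes. -/
def gossipStep (E : Finset (V × V)) (W : Matrix V V ℝ) (v : V → ℝ) (e : V × V) (x : V → ℝ) :
    V → ℝ :=
  Function.update x e.1
    (obstinacy E W e.1 *
        ((1 - gossipWeight E W e.1 e.2) * x e.1 + gossipWeight E W e.1 e.2 * x e.2)
      + (1 - obstinacy E W e.1) * v e.1)

/-- The opinion process started at `x(0) = v`, driven by the sequence of selected edges `θ`. -/
def gossipProcess {Ω : Type*} (E : Finset (V × V)) (W : Matrix V V ℝ) (v : V → ℝ)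
    (θ : ℕ → Ω → V × V) : ℕ → Ω → V → ℝ
  | 0, _ => v
  | k + 1, ω => gossipStep E W v (θ k ω) (gossipProcess E W v θ k ω)

end Dynamics

noncomputable section Ergodicity

variable {V Ω : Type*}

/-- The time average `(1/k) ∑_{ℓ=0}^{k-1} x(ℓ)`. -/
def timeAverage (x : ℕ → Ω → V → ℝ) (k : ℕ) (ω : Ω) : V → ℝ :=
  (1 / (k : ℝ)) • ∑ l ∈ Finset.range k, x l ω

variable [Fintype V] [MeasurableSpace Ω]

/-- `y k` converges almost surely to the deterministic vector `m`. -/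
def TendstoAS (y : ℕ → Ω → V → ℝ) (μ : Measure Ω) (m : V → ℝ) : Prop :=
  ∀ᵐ ω ∂μ, Tendsto (fun k => y k ω) atTop (𝓝 m)

/-- `E[‖y k - m‖₂²]` is finite for all `k` and tends to zero (Euclidean norm). -/
def TendstoMS (y : ℕ → Ω → V → ℝ) (μ : Measure Ω) (m : V → ℝ) : Prop :=
  (∀ k, Integrable (fun ω => ‖WithLp.toLp 2 (y k ω - m)‖ ^ 2) μ) ∧
    Tendsto (fun k => ∫ ω, ‖WithLp.toLp 2 (y k ω - m)‖ ^ 2 ∂μ) atTop (𝓝 0)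

/-- Almost sure ergodicity: for some integrable random vector `xInf`, the time averages converge
almost surely to its expectation. -/
def ErgodicAS (x : ℕ → Ω → V → ℝ) (μ : Measure Ω) : Prop :=
  ∃ xInf : Ω → V → ℝ, Integrable xInf μ ∧ TendstoAS (timeAverage x) μ (∫ ω, xInf ω ∂μ)

/-- Mean-square ergodicity: for some integrable random vector `xInf`, the time averages converge
in mean square to its expectation. -/
def ErgodicMS (x : ℕ → Ω → V → ℝ) (μ : Measure Ω) : Prop :=
  ∃ xInf : Ω → V → ℝ, Integrable xInf μ ∧ TendstoMS (timeAverage x) μ (∫ ω, xInf ω ∂μ)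

end Ergodicity

end GossipOpinion

/-! The opinions keep fluctuating, but the coefficients are calibrated so that the mean update over
a uniform edge is x + |E|⁻¹((I - Λ)v - (I - ΛW)x) (`sum_gossipStep_sub`). Split each increment into
this drift and a noise term, sum over time and divide by k: (I - ΛW) applied to the time average is
(I - Λ)v plus |E| times noise/k and a boundary term/k (`mulVec_timeAverage`). Updates preserve
sup-norm balls containing v, so the boundary term vanishes. The noise is a martingale with bounded
increments, and a strong law (`ae_tendsto_div_of_orthogonal`) removes it almost surely. A maximum
principle along paths of W makes I - ΛW invertible (`mulVec_eq_zero`). Mean-square convergence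
follows by dominated convergence.

The vector x_∞ is the almost sure limit of the updates composed in reverse order. There the newest
update is innermost, so successive iterates differ by a linear product of updates, whose expectation
is a power of `meanMatrix`. A geometric sum gives summability (`ae_summable_backwardIterate_one`),
and a fixed-point argument identifies the mean (`exists_backwardIterate_limit`). -/

namespace GossipOpinion

/-! ### Algebra and order properties of a single update; invertibility of I - ΛW -/

section Step

theorem sensitivity_diag {V : Type*} [DecidableEq V] (W : Matrix V V ℝ) (i : V) :
    sensitivity W i i = 1 - W i i := by
  simp [sensitivity]

variable {V : Type*} [Fintype V]

/-- `W` is a row-stochastic nonnegative matrix adapted to a graph `E` with all self-loops. -/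
structure IsAdaptedStochastic (E : Finset (V × V)) (W : Matrix V V ℝ) : Prop where
  loop : ∀ i, (i, i) ∈ E
  nonneg : ∀ i j, 0 ≤ W i j
  sum_eq_one : ∀ i, ∑ j, W i j = 1
  adapted : ∀ i j, (i, j) ∉ E → W i j = 0

theorem IsAdaptedStochastic.le_one {E : Finset (V × V)} {W : Matrix V V ℝ}
    (hW : IsAdaptedStochastic E W) (i j : V) : W i j ≤ 1 := by
  rw [← hW.sum_eq_one i]
  exact Finset.single_le_sum (fun k _ => hW.nonneg i k) (Finset.mem_univ j)

variable [DecidableEq V]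

theorem sensitivity_mul_mulVec (W : Matrix V V ℝ) (x : V → ℝ) (i : V) :
    ((sensitivity W * W) *ᵥ x) i = (1 - W i i) * ∑ j, W i j * x j := by
  rw [← Matrix.mulVec_mulVec, sensitivity, Matrix.sub_mulVec, Pi.sub_apply, Matrix.one_mulVec,
    Matrix.mulVec_diagonal, sub_mul, one_mul]
  rfl

theorem one_sub_sensitivity_mulVec (W : Matrix V V ℝ) (v : V → ℝ) (i : V) :
    ((1 - sensitivity W) *ᵥ v) i = W i i * v i := by
  simp [sensitivity, Matrix.mulVec_diagonal]

/-- Differences of updates are updates of differences. -/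
theorem gossipStep_sub (E : Finset (V × V)) (W : Matrix V V ℝ) (v w : V → ℝ) (e : V × V)
    (x y : V → ℝ) :
    gossipStep E W v e x - gossipStep E W w e y = gossipStep E W (v - w) e (x - y) := by
  funext i
  by_cases h : i = e.1
  · subst h
    simp [gossipStep]
    ring
  · simp [gossipStep, h]

theorem gossipStep_smul (E : Finset (V × V)) (W : Matrix V V ℝ) (v : V → ℝ) (e : V × V) (c : ℝ)
    (x : V → ℝ) :
    gossipStep E W (c • v) e (c • x) = c • gossipStep E W v e x := by
  funext i
  by_cases h : i = e.1
  · subst h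
    simp [gossipStep]
    ring
  · simp [gossipStep, h]

/-- Updates commute with finite affine combinations. -/
theorem gossipStep_sum {ι : Type*} (E : Finset (V × V)) (W : Matrix V V ℝ) (v : V → ℝ)
    (e : V × V) (s : Finset ι) (c : ι → ℝ) (hc : ∑ a ∈ s, c a = 1) (x : ι → V → ℝ) :
    gossipStep E W v e (∑ a ∈ s, c a • x a) = ∑ a ∈ s, c a • gossipStep E W v e (x a) := by
  funext i
  by_cases h : i = e.1
  · subst h
    have hv : (1 - obstinacy E W e.1) * v e.1
        = ∑ a ∈ s, c a * ((1 - obstinacy E W e.1) * v e.1) := by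
      rw [← Finset.sum_mul, hc, one_mul]
    simp only [gossipStep, Function.update_self, Finset.sum_apply, Pi.smul_apply, smul_eq_mul]
    conv_lhs => rw [hv]
    simp only [mul_add, Finset.mul_sum, ← Finset.sum_add_distrib]
    refine Finset.sum_congr rfl fun a _ => ?_
    ring
  · simp [gossipStep, h]

variable {E : Finset (V × V)} {W : Matrix V V ℝ}

namespace IsAdaptedStochastic

theorem outDegree_pos (hW : IsAdaptedStochastic E W) (i : V) : 0 < outDegree E i :=
  Finset.card_pos.2 ⟨i, by simp [hW.loop i]⟩

theorem eq_of_outDegree_eq_one (hW : IsAdaptedStochastic E W) {i j : V}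
    (hd : outDegree E i = 1) (he : (i, j) ∈ E) : j = i :=
  Finset.card_le_one.1 hd.le j (by simp [he]) i (by simp [hW.loop i])

theorem diag_eq_one (hW : IsAdaptedStochastic E W) {i : V} (hd : outDegree E i = 1) :
    W i i = 1 := by
  rw [← hW.sum_eq_one i]
  refine (Finset.sum_eq_single i (fun j _ hj => ?_) (by simp)).symm
  exact hW.adapted i j fun he => hj (hW.eq_of_outDegree_eq_one hd he)

/-- This is the calibration behind `obstinacy`: summed over the edges leaving i, the pull towards v
i has weight W i i. For out-degree 1 it survives because W i i is then forced to be 1. -/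
theorem outDegree_mul_one_sub_obstinacy (hW : IsAdaptedStochastic E W) (i : V) :
    (outDegree E i : ℝ) * (1 - obstinacy E W i) = W i i := by
  by_cases hd : outDegree E i = 1
  · simp [obstinacy, hd, hW.diag_eq_one hd]
  · have : (outDegree E i : ℝ) ≠ 0 := by exact_mod_cast (hW.outDegree_pos i).ne'
    simp only [obstinacy, ne_eq, hd, not_false_eq_true, if_true, sensitivity_diag]
    field_simp
    ring

theorem one_sub_diag_le_obstinacy (hW : IsAdaptedStochastic E W) (i : V) :
    1 - W i i ≤ obstinacy E W i := by
  have h1 := hW.outDegree_mul_one_sub_obstinacy i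
  have h2 : (1 : ℝ) ≤ outDegree E i := by exact_mod_cast hW.outDegree_pos i
  nlinarith [hW.nonneg i i]

theorem obstinacy_nonneg (hW : IsAdaptedStochastic E W) (i : V) : 0 ≤ obstinacy E W i :=
  (sub_nonneg.2 (hW.le_one i i)).trans (hW.one_sub_diag_le_obstinacy i)

theorem obstinacy_le_one (hW : IsAdaptedStochastic E W) (i : V) : obstinacy E W i ≤ 1 := by
  have h1 := hW.outDegree_mul_one_sub_obstinacy i
  have h2 : (1 : ℝ) ≤ outDegree E i := by exact_mod_cast hW.outDegree_pos i
  nlinarith [hW.nonneg i i]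

theorem obstinacy_ne_zero (hW : IsAdaptedStochastic E W) {i : V} (hd : outDegree E i ≠ 1) :
    obstinacy E W i ≠ 0 := by
  intro h
  have h1 := hW.outDegree_mul_one_sub_obstinacy i
  have h2 : (2 : ℝ) ≤ outDegree E i := by
    have := hW.outDegree_pos i
    exact_mod_cast (show 2 ≤ outDegree E i by omega)
  rw [h] at h1
  linarith [hW.le_one i i]

/-- On a self-loop x i is mixed with itself, so the diagonal `gossipWeight` drops out. A non-loop
edge forces out-degree at least 2, so h i is nonzero and cancels the denominator. -/
theorem gossipStep_self (hW : IsAdaptedStochastic E W) (v x : V → ℝ) {i j : V}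
    (he : (i, j) ∈ E) :
    gossipStep E W v (i, j) x i
      = x i + (1 - W i i) * W i j * (x j - x i) + (1 - obstinacy E W i) * (v i - x i) := by
  simp only [gossipStep, Function.update_self]
  by_cases hij : i = j
  · subst hij
    ring
  · have hd : outDegree E i ≠ 1 := fun hd => hij (hW.eq_of_outDegree_eq_one hd he).symm
    have := hW.obstinacy_ne_zero hd
    simp only [gossipWeight, ne_eq, hd, not_false_eq_true, if_true, hij, if_false,
      sensitivity_diag]
    field_simp
    ring

/-- Along a non-loop edge (i, j) the new opinion has coefficients h i - λ i W i j, λ i W i j and 1 -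
h i on x i, x j and v i. All are nonnegative because λ i W i j ≤ λ i ≤ h i ≤ 1. -/
theorem gossipStep_mono (hW : IsAdaptedStochastic E W) {v w x y : V → ℝ} {e : V × V}
    (he : e ∈ E) (hv : v ≤ w) (hx : x ≤ y) : gossipStep E W v e x ≤ gossipStep E W w e y := by
  obtain ⟨i, j⟩ := e
  rw [← sub_nonneg, gossipStep_sub]
  intro l
  by_cases hl : l = i
  · subst hl
    rw [hW.gossipStep_self _ _ he]
    have h1 := sub_nonneg.2 (hv l)
    have h2 := sub_nonneg.2 (hx l)
    have h3 := sub_nonneg.2 (hx j)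
    have h4 := hW.obstinacy_nonneg l
    have h5 := sub_nonneg.2 (hW.obstinacy_le_one l)
    simp only [Pi.sub_apply, Pi.zero_apply]
    by_cases hlj : l = j
    · subst hlj
      nlinarith [mul_nonneg h4 h2, mul_nonneg h5 h1]
    · have h6 : (1 - W l l) * W l j ≤ obstinacy E W l :=
        (mul_le_of_le_one_right (sub_nonneg.2 (hW.le_one l l)) (hW.le_one l j)).trans
          (hW.one_sub_diag_le_obstinacy l)
      have h7 := mul_nonneg (mul_nonneg (sub_nonneg.2 (hW.le_one l l)) (hW.nonneg l j)) h3
      nlinarith [mul_nonneg (sub_nonneg.2 h6) h2, mul_nonneg h5 h1]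
  · simpa [gossipStep, hl] using hx l

theorem gossipStep_const (hW : IsAdaptedStochastic E W) (c : ℝ) {e : V × V} (he : e ∈ E) :
    gossipStep E W (fun _ => c) e (fun _ => c) = fun _ => c := by
  obtain ⟨i, j⟩ := e
  funext l
  by_cases hl : l = i
  · subst hl
    simp [hW.gossipStep_self _ _ he]
  · simp [gossipStep, hl]

/-- Updates along edges preserve every order box that contains `v`. -/
theorem abs_gossipStep_le (hW : IsAdaptedStochastic E W) {v x : V → ℝ} {C : ℝ} {e : V × V}
    (he : e ∈ E) (hv : ∀ i, |v i| ≤ C) (hx : ∀ i, |x i| ≤ C) (i : V) :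
    |gossipStep E W v e x i| ≤ C := by
  refine abs_le.2 ⟨?_, ?_⟩
  · have := hW.gossipStep_mono he (v := fun _ => -C) (x := fun _ => -C)
      (fun i => (abs_le.1 (hv i)).1) (fun i => (abs_le.1 (hx i)).1) i
    rwa [hW.gossipStep_const _ he] at this
  · have := hW.gossipStep_mono he (w := fun _ => C) (y := fun _ => C)
      (fun i => (abs_le.1 (hv i)).2) (fun i => (abs_le.1 (hx i)).2) i
    rwa [hW.gossipStep_const _ he] at this

/-- The total increment of one update over all edges. -/
theorem sum_gossipStep_sub (hW : IsAdaptedStochastic E W) (v x : V → ℝ) (i : V) :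
    ∑ e ∈ E, (gossipStep E W v e x i - x i)
      = ((1 - sensitivity W) *ᵥ v) i - ((1 - sensitivity W * W) *ᵥ x) i := by
  have h1 : ∑ e ∈ E, (gossipStep E W v e x i - x i)
      = ∑ j ∈ Finset.univ.filter (fun j : V => (i, j) ∈ E),
          (gossipStep E W v (i, j) x i - x i) := by
    symm
    refine Finset.sum_of_injOn (fun j => (i, j)) (by simp [Set.InjOn]) (by simp [Set.MapsTo])
      ?_ (fun _ _ => rfl)
    rintro ⟨a, b⟩ hab hnot
    have hai : i ≠ a := by
      rintro rfl
      exact hnot ⟨b, by simpa using hab, rfl⟩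
    simp [gossipStep, hai]
  have h2 : ∀ j ∈ Finset.univ.filter (fun j : V => (i, j) ∈ E),
      gossipStep E W v (i, j) x i - x i
        = (1 - W i i) * (W i j * (x j - x i)) + (1 - obstinacy E W i) * (v i - x i) := by
    intro j hj
    rw [hW.gossipStep_self _ _ (by simpa using hj)]
    ring
  -- Non-neighbours carry zero weight, so the sum extends to all nodes and the row sum 1 applies.
  have h3 : ∑ j ∈ Finset.univ.filter (fun j : V => (i, j) ∈ E), W i j * (x j - x i)
      = ∑ j, W i j * x j - x i := by
    rw [Finset.sum_subset (Finset.subset_univ _)]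
    · simp only [mul_sub, Finset.sum_sub_distrib, ← Finset.sum_mul, hW.sum_eq_one, one_mul]
    · intro j _ hj
      rw [hW.adapted i j (by simpa using hj), zero_mul]
  rw [h1, Finset.sum_congr rfl h2, Finset.sum_add_distrib, ← Finset.mul_sum, h3,
    Finset.sum_const, nsmul_eq_mul, ← mul_assoc]
  change _ + (outDegree E i : ℝ) * _ * _ = _
  rw [hW.outDegree_mul_one_sub_obstinacy, one_sub_sensitivity_mulVec, Matrix.sub_mulVec,
    Pi.sub_apply, sensitivity_mul_mulVec, Matrix.one_mulVec]
  ring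

/-- Maximum principle: if x = ΛWx is nonzero, a node maximising |x| must have W i i = 0, and every
W-successor is again a maximiser. Following a path to a node with positive diagonal gives a
contradiction. -/
theorem mulVec_eq_zero (hW : IsAdaptedStochastic E W)
    (hpath : ∀ l, ∃ i, 0 < W i i ∧ HasPath (assocEdges W) l i) {x : V → ℝ}
    (hx : (1 - sensitivity W * W) *ᵥ x = 0) : x = 0 := by
  rcases isEmpty_or_nonempty V with hV | hV
  · exact Subsingleton.elim _ _
  have hfix : ∀ i, x i = (1 - W i i) * ∑ j, W i j * x j := by
    intro i
    have := congrFun hx i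
    rw [Matrix.sub_mulVec, Pi.sub_apply, sensitivity_mul_mulVec, Matrix.one_mulVec] at this
    exact sub_eq_zero.1 this
  obtain ⟨m, hm⟩ := Finite.exists_max fun i => |x i|
  by_contra hne
  have hpos : 0 < |x m| := by
    obtain ⟨i, hi⟩ := Function.ne_iff.1 hne
    exact (abs_pos.2 hi).trans_le (hm i)
  have hsum : ∀ i, ∑ j, W i j * |x j| ≤ |x m| := fun i => calc
    ∑ j, W i j * |x j| ≤ ∑ j, W i j * |x m| :=
      Finset.sum_le_sum fun j _ => mul_le_mul_of_nonneg_left (hm j) (hW.nonneg i j)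
    _ = |x m| := by rw [← Finset.sum_mul, hW.sum_eq_one, one_mul]
  have hle : ∀ i, |x i| ≤ (1 - W i i) * ∑ j, W i j * |x j| := fun i => by
    conv_lhs => rw [hfix i]
    rw [abs_mul, abs_of_nonneg (sub_nonneg.2 (hW.le_one i i))]
    refine mul_le_mul_of_nonneg_left ((Finset.abs_sum_le_sum_abs _ _).trans_eq ?_)
      (sub_nonneg.2 (hW.le_one i i))
    exact Finset.sum_congr rfl fun j _ => by rw [abs_mul, abs_of_nonneg (hW.nonneg i j)]
  have hdiag : ∀ i, |x i| = |x m| → W i i = 0 := fun i hi => by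
    have h1 := mul_le_mul_of_nonneg_left (hsum i) (sub_nonneg.2 (hW.le_one i i))
    have h2 := hle i
    rw [hi] at h2
    nlinarith [hW.nonneg i i]
  have hnext : ∀ i j, |x i| = |x m| → 0 < W i j → |x j| = |x m| := fun i j hi hij => by
    by_contra hj
    have h1 : ∑ j, W i j * |x j| < ∑ j, W i j * |x m| :=
      Finset.sum_lt_sum (fun j _ => mul_le_mul_of_nonneg_left (hm j) (hW.nonneg i j))
        ⟨j, Finset.mem_univ j, mul_lt_mul_of_pos_left (lt_of_le_of_ne (hm j) hj) hij⟩
    rw [← Finset.sum_mul, hW.sum_eq_one, one_mul] at h1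
    have h2 := hle i
    rw [hi, hdiag i hi] at h2
    linarith
  obtain ⟨i, hi, hp⟩ := hpath m
  have hmax : |x i| = |x m| := by
    clear hi
    induction hp with
    | refl => rfl
    | tail _ hbc ih => exact hnext _ _ ih hbc
  exact hi.ne' (hdiag i hmax)

theorem isUnit_det (hW : IsAdaptedStochastic E W)
    (hpath : ∀ l, ∃ i, 0 < W i i ∧ HasPath (assocEdges W) l i) :
    IsUnit (1 - sensitivity W * W).det := by
  rw [← Matrix.isUnit_iff_isUnit_det, ← Matrix.mulVec_injective_iff_isUnit]
  intro x y hxy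
  refine sub_eq_zero.1 (hW.mulVec_eq_zero hpath ?_)
  rw [Matrix.mulVec_sub, sub_eq_zero]
  exact hxy

end IsAdaptedStochastic

end Step

/-! ### A strong law for bounded orthogonal increments -/

section OrthogonalIncrements

variable {Ω : Type*} [MeasurableSpace Ω] {μ : Measure Ω}

/-- By monotone convergence the sum of the series has finite integral, hence is finite almost
everywhere. -/
theorem ae_summable_of_sum_integral_le {f : ℕ → Ω → ℝ} (hf : ∀ n, 0 ≤ᵐ[μ] f n)
    (hint : ∀ n, Integrable (f n) μ) {c : ℝ}
    (hc : ∀ n, ∑ i ∈ Finset.range n, ∫ ω, f i ω ∂μ ≤ c) :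
    ∀ᵐ ω ∂μ, Summable fun n => f n ω := by
  have hm : ∀ n, AEMeasurable (fun ω => ENNReal.ofReal (f n ω)) μ :=
    fun n => (hint n).aemeasurable.ennreal_ofReal
  have hfin : ∫⁻ ω, ∑' n, ENNReal.ofReal (f n ω) ∂μ ≠ ⊤ := by
    rw [lintegral_tsum hm]
    refine ne_top_of_le_ne_top (b := ENNReal.ofReal c) ENNReal.ofReal_ne_top
      (ENNReal.tsum_le_of_sum_range_le fun n => ?_)
    calc ∑ i ∈ Finset.range n, ∫⁻ ω, ENNReal.ofReal (f i ω) ∂μ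
        = ∑ i ∈ Finset.range n, ENNReal.ofReal (∫ ω, f i ω ∂μ) :=
          Finset.sum_congr rfl fun i _ =>
            (ofReal_integral_eq_lintegral_ofReal (hint i) (hf i)).symm
      _ = ENNReal.ofReal (∑ i ∈ Finset.range n, ∫ ω, f i ω ∂μ) :=
          (ENNReal.ofReal_sum_of_nonneg fun i _ => integral_nonneg_of_ae (hf i)).symm
      _ ≤ ENNReal.ofReal c := ENNReal.ofReal_le_ofReal (hc n)
  filter_upwards [ae_lt_top' (AEMeasurable.tsum hm) hfin, ae_all_iff.2 hf] with ω hω hfω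
  simpa [fun n => ENNReal.toReal_ofReal (hfω n)] using ENNReal.summable_toReal hω.ne

variable [IsProbabilityMeasure μ] {Y : ℕ → Ω → ℝ} {C : ℝ}

/-- Expanding the square of Y k plus an increment, the cross term integrates to zero and the squared
increment costs at most C². -/
theorem integral_sq_le_of_orthogonal (h0 : ∀ ω, Y 0 ω = 0)
    (hint : ∀ j k, Integrable (fun ω => Y j ω * Y k ω) μ)
    (hC : ∀ k, ∀ᵐ ω ∂μ, |Y (k + 1) ω - Y k ω| ≤ C)
    (horth : ∀ k, ∫ ω, Y k ω * (Y (k + 1) ω - Y k ω) ∂μ = 0) (k : ℕ) :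
    ∫ ω, Y k ω * Y k ω ∂μ ≤ k * C ^ 2 := by
  induction k with
  | zero => simp [h0]
  | succ k ih =>
    have hcross : Integrable (fun ω => Y k ω * (Y (k + 1) ω - Y k ω)) μ := by
      simpa only [mul_sub, Pi.sub_def] using (hint k (k + 1)).sub (hint k k)
    have hsum : Integrable
        (fun ω => Y k ω * Y k ω + 2 * (Y k ω * (Y (k + 1) ω - Y k ω))) μ :=
      (hint k k).add (hcross.const_mul 2)
    calc ∫ ω, Y (k + 1) ω * Y (k + 1) ω ∂μ
        ≤ ∫ ω, (Y k ω * Y k ω + 2 * (Y k ω * (Y (k + 1) ω - Y k ω)) + C ^ 2) ∂μ := by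
          refine integral_mono_ae (hint _ _)
            (hsum.add (integrable_const _)) ?_
          filter_upwards [hC k] with ω hω
          have := sq_le_sq' (abs_le.1 hω).1 (abs_le.1 hω).2
          nlinarith
      _ = ∫ ω, Y k ω * Y k ω ∂μ + 2 * 0 + C ^ 2 := by
          rw [integral_add hsum (integrable_const _),
            integral_add (hint k k) (hcross.const_mul 2), integral_const_mul, horth]
          simp
      _ ≤ ((k + 1 : ℕ) : ℝ) * C ^ 2 := by
          push_cast
          linarith

/-- The strong law of large numbers for bounded orthogonal increments. -/
theorem ae_tendsto_div_of_orthogonal (h0 : ∀ ω, Y 0 ω = 0)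
    (hint : ∀ j k, Integrable (fun ω => Y j ω * Y k ω) μ)
    (hC : ∀ k, ∀ᵐ ω ∂μ, |Y (k + 1) ω - Y k ω| ≤ C)
    (horth : ∀ k, ∫ ω, Y k ω * (Y (k + 1) ω - Y k ω) ∂μ = 0) :
    ∀ᵐ ω ∂μ, Tendsto (fun k : ℕ => Y k ω / k) atTop (𝓝 0) := by
  -- Along the squares, Y(n²)/n² has second moment at most C²/n², which is summable.
  have hsq : ∀ᵐ ω ∂μ, Summable fun n : ℕ =>
      Y (n * n) ω * Y (n * n) ω * (((n : ℝ) ^ 2)⁻¹) ^ 2 := by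
    have hs : Summable fun n : ℕ => C ^ 2 * ((n : ℝ) ^ 2)⁻¹ :=
      (Real.summable_nat_pow_inv.2 one_lt_two).mul_left _
    refine ae_summable_of_sum_integral_le
      (fun n => ae_of_all _ fun ω => mul_nonneg (mul_self_nonneg _) (sq_nonneg _))
      (fun n => (hint _ _).mul_const _) (c := ∑' n : ℕ, C ^ 2 * ((n : ℝ) ^ 2)⁻¹) fun n => ?_
    refine le_trans (Finset.sum_le_sum fun i _ => ?_)
      (hs.sum_le_tsum (Finset.range n) fun i _ => by positivity)
    rw [integral_mul_const]
    refine (mul_le_mul_of_nonneg_right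
      (integral_sq_le_of_orthogonal h0 hint hC horth (i * i)) (sq_nonneg _)).trans_eq ?_
    rcases eq_or_ne i 0 with rfl | hi
    · simp
    · have : (i : ℝ) ≠ 0 := by exact_mod_cast hi
      push_cast
      field_simp
  filter_upwards [hsq, ae_all_iff.2 hC] with ω hω hCω
  have hC0 : 0 ≤ C := (abs_nonneg _).trans (hCω 0)
  have hY : ∀ n k, |Y (n + k) ω - Y n ω| ≤ k * C := by
    intro n k
    induction k with
    | zero => simp
    | succ k ih =>
      have := abs_sub_le (Y (n + (k + 1)) ω) (Y (n + k) ω) (Y n ω)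
      have h2 : |Y (n + (k + 1)) ω - Y (n + k) ω| ≤ C := hCω (n + k)
      push_cast
      linarith
  have hsub : Tendsto (fun n : ℕ => |Y (n * n) ω| * ((n : ℝ) ^ 2)⁻¹) atTop (𝓝 0) := by
    have := hω.tendsto_atTop_zero.sqrt
    rw [Real.sqrt_zero] at this
    refine this.congr fun n => ?_
    rw [show Y (n * n) ω * Y (n * n) ω * (((n : ℝ) ^ 2)⁻¹) ^ 2
      = (|Y (n * n) ω| * ((n : ℝ) ^ 2)⁻¹) ^ 2 by rw [mul_pow, sq_abs]; ring]
    exact Real.sqrt_sq (by positivity)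
  have hlim : Tendsto (fun n : ℕ => |Y (n * n) ω| * ((n : ℝ) ^ 2)⁻¹ + 2 * C * ((n : ℝ))⁻¹)
      atTop (𝓝 0) := by
    simpa using hsub.add (tendsto_inv_atTop_nhds_zero_nat.const_mul (2 * C))
  -- Interpolate: with n = ⌊√k⌋ the gap k - n² is at most 2n, so Y moves by at most 2nC, negligible
  -- against n² ≤ k.
  have hsqrt : Tendsto Nat.sqrt atTop atTop :=
    tendsto_atTop.2 fun b => eventually_atTop.2 ⟨b * b, fun k hk => Nat.le_sqrt.2 hk⟩
  refine squeeze_zero_norm' ?_ (hlim.comp hsqrt)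
  filter_upwards [eventually_ge_atTop 1] with k hk
  set n := Nat.sqrt k with hn
  have hn1 : 1 ≤ n := Nat.le_sqrt.2 (by simpa using hk)
  have hnk : n * n ≤ k := Nat.sqrt_le k
  have hkn : k - n * n ≤ 2 * n := by
    have : k ≤ n * n + n + n := Nat.sqrt_le_add k
    omega
  have hb := hY (n * n) (k - n * n)
  rw [Nat.add_sub_cancel' hnk] at hb
  have h1 : |Y k ω| ≤ |Y (n * n) ω| + 2 * n * C := by
    have h2 : ((k - n * n : ℕ) : ℝ) ≤ 2 * n := by exact_mod_cast hkn
    have h3 := mul_le_mul_of_nonneg_right h2 hC0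
    have h4 := abs_sub_abs_le_abs_sub (Y k ω) (Y (n * n) ω)
    linarith
  have hn0 : (0 : ℝ) < n := by exact_mod_cast hn1
  have hnk' : (n : ℝ) ^ 2 ≤ k := by
    rw [sq]
    exact_mod_cast hnk
  simp only [Function.comp_apply, Real.norm_eq_abs, abs_div, Nat.abs_cast, ← hn]
  calc |Y k ω| / k ≤ (|Y (n * n) ω| + 2 * n * C) / (n : ℝ) ^ 2 :=
        div_le_div₀ (by positivity) h1 (by positivity) hnk'
    _ = |Y (n * n) ω| * ((n : ℝ) ^ 2)⁻¹ + 2 * C * (n : ℝ)⁻¹ := by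
        field_simp

end OrthogonalIncrements

/-! ### Independent uniform draws and functions of the past -/

section UniformDriving

/-- `θ` is a sequence of independent random elements, each uniform on `E`. -/
structure IsUniformDriving {Ω β : Type*} [MeasurableSpace Ω] [MeasurableSpace β]
    (θ : ℕ → Ω → β) (E : Finset β) (μ : Measure Ω) : Prop where
  measurable : ∀ k, Measurable (θ k)
  indep : iIndepFun θ μ
  unif : ∀ k, μ.map (θ k) = uniformOn (E : Set β)

namespace IsUniformDriving

/-- `uniformOn` of the empty set is the zero measure, which cannot be the law of a random element
under a probability measure. -/
theorem nonempty
    {Ω β : Type*} [MeasurableSpace Ω] [MeasurableSpace β]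
    {μ : Measure Ω} [IsProbabilityMeasure μ] {θ : ℕ → Ω → β} {E : Finset β}
    (hθ : IsUniformDriving θ E μ) :
    E.Nonempty := by
  have := Measure.isProbabilityMeasure_map (μ := μ) (hθ.measurable 0).aemeasurable
  have h := hθ.unif 0
  by_contra hE
  rw [Finset.not_nonempty_iff_eq_empty.1 hE, Finset.coe_empty, uniformOn_empty_meas] at h
  exact IsProbabilityMeasure.ne_zero (μ.map (θ 0)) h

theorem ae_forall_mem
    {Ω β : Type*} [MeasurableSpace Ω] [MeasurableSpace β] [MeasurableSingletonClass β]
    {μ : Measure Ω} {θ : ℕ → Ω → β} {E : Finset β} (hθ : IsUniformDriving θ E μ) :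
    ∀ᵐ ω ∂μ, ∀ k, θ k ω ∈ E := by
  refine ae_all_iff.2 fun k => ae_of_ae_map (hθ.measurable k).aemeasurable (p := fun e => e ∈ E) ?_
  rw [hθ.unif, ae_iff]
  refine (uniformOn_eq_zero_iff E.finite_toSet).2 ?_
  ext e
  simp

end IsUniformDriving

variable {Ω β γ : Type*}

/-- `Z` is a function of the first `k` terms of the driving sequence `θ`. -/
def DeterminedByPast (θ : ℕ → Ω → β) (k : ℕ) (Z : Ω → γ) : Prop :=
  ∀ ω ω', (∀ l < k, θ l ω = θ l ω') → Z ω = Z ω'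

/-- Reduces Z to a function on a finite product when β is finite; then measurability and
integrability are automatic. Values of F off the range of the past are arbitrary. -/
theorem DeterminedByPast.exists_comp [Nonempty γ] {θ : ℕ → Ω → β} {k : ℕ} {Z : Ω → γ}
    (hZ : DeterminedByPast θ k Z) :
    ∃ F : (Finset.range k → β) → γ, ∀ ω, Z ω = F fun l => θ l ω := by
  have hf : Function.FactorsThrough Z fun ω (l : Finset.range k) => θ l ω :=
    fun ω ω' h => hZ ω ω' fun l hl => congrFun h ⟨l, Finset.mem_range.2 hl⟩
  exact ⟨Function.extend _ Z fun _ => Classical.arbitrary γ, fun ω => (hf.extend_apply _ ω).symm⟩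

theorem DeterminedByPast.mono {θ : ℕ → Ω → β} {j k : ℕ} {Z : Ω → γ}
    (hZ : DeterminedByPast θ j Z) (hjk : j ≤ k) : DeterminedByPast θ k Z :=
  fun ω ω' h => hZ ω ω' fun l hl => h l (hl.trans_le hjk)

variable [MeasurableSpace Ω] [Finite β] [MeasurableSpace β] [MeasurableSingletonClass β]
  {μ : Measure Ω} [IsProbabilityMeasure μ] {θ : ℕ → Ω → β} {k : ℕ}

theorem DeterminedByPast.measurable [MeasurableSpace γ] {Z : Ω → γ}
    (hZ : DeterminedByPast θ k Z) (hθ : ∀ k, Measurable (θ k)) : Measurable Z := by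
  rcases isEmpty_or_nonempty γ with h | h
  · have : IsEmpty Ω := ⟨fun ω => h.elim (Z ω)⟩
    exact measurable_of_empty _
  obtain ⟨F, hF⟩ := hZ.exists_comp
  rw [show Z = F ∘ fun ω l => θ l ω from funext hF]
  exact (measurable_of_finite F).comp (measurable_pi_lambda _ fun l => hθ l)

theorem DeterminedByPast.integrable {Z : Ω → ℝ}
    (hZ : DeterminedByPast θ k Z) (hθ : ∀ k, Measurable (θ k)) : Integrable Z μ := by
  obtain ⟨F, hF⟩ := hZ.exists_comp
  have hm : Measurable fun ω (l : Finset.range k) => θ l ω :=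
    measurable_pi_lambda _ fun l => hθ l
  have := Measure.isProbabilityMeasure_map (μ := μ) hm.aemeasurable
  rw [show Z = F ∘ fun ω l => θ l ω from funext hF]
  exact Integrable.comp_measurable Integrable.of_finite hm

theorem integral_uniformOn_finset (E : Finset β) (hE : E.Nonempty) (f : β → ℝ) :
    ∫ e, f e ∂(uniformOn (E : Set β)) = (E.card : ℝ)⁻¹ * ∑ e ∈ E, f e := by
  classical
  have := Fintype.ofFinite β
  have := isProbabilityMeasure_uniformOn E.finite_toSet (by simpa using hE)
  rw [integral_fintype Integrable.of_finite, Finset.mul_sum,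
    ← Finset.sum_subset (Finset.subset_univ E)]
  · refine Finset.sum_congr rfl fun e he => ?_
    rw [measureReal_def, ← Finset.coe_singleton, uniformOn_apply_finset,
      Finset.inter_singleton_of_mem he]
    simp
  · intro e _ he
    rw [measureReal_def, ← Finset.coe_singleton, uniformOn_apply_finset,
      Finset.inter_singleton_of_notMem he]
    simp

namespace IsUniformDriving

variable {E : Finset β}

/-- Averaging out the next driving variable, which is uniform and independent of the past. -/
theorem integral_next_eq_average (hθ : IsUniformDriving θ E μ)
    {Φ : β → Ω → ℝ} (hΦ : ∀ e, DeterminedByPast θ k (Φ e)) :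
    ∫ ω, Φ (θ k ω) ω ∂μ = ∫ ω, (E.card : ℝ)⁻¹ * ∑ e ∈ E, Φ e ω ∂μ := by
  choose F hF using fun e => (hΦ e).exists_comp
  set H : Ω → Finset.range k → β := fun ω l => θ l ω
  have hH : Measurable H := measurable_pi_lambda _ fun l => hθ.measurable l
  -- The index sets {0, …, k - 1} and {k} are disjoint, so the joint law of past and next draw is a
  -- product and Fubini integrates out the draw.
  have hHθ : IndepFun H (θ k) μ := by
    have := hθ.indep.indepFun_finset (Finset.range k) {k} (by simp) hθ.measurable
    exact this.comp (φ := id)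
      (ψ := fun z : (({k} : Finset ℕ) → β) => z ⟨k, Finset.mem_singleton_self k⟩)
      measurable_id (measurable_pi_apply _)
  have hmap := (indepFun_iff_map_prod_eq_prod_map_map hH.aemeasurable
    (hθ.measurable k).aemeasurable).1 hHθ
  have := isProbabilityMeasure_uniformOn E.finite_toSet (by simpa using hθ.nonempty)
  have := Measure.isProbabilityMeasure_map (μ := μ) hH.aemeasurable
  calc ∫ ω, Φ (θ k ω) ω ∂μ
      = ∫ ω, (fun z : (Finset.range k → β) × β => F z.2 z.1) (H ω, θ k ω) ∂μ := by
        simp only [hF, H]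
    _ = ∫ z, F z.2 z.1 ∂(μ.map fun ω => (H ω, θ k ω)) :=
        (integral_map (f := fun z : (Finset.range k → β) × β => F z.2 z.1)
          (hH.prodMk (hθ.measurable k)).aemeasurable (measurable_of_finite _).aestronglyMeasurable).symm
    _ = ∫ a, ∫ e, F e a ∂(uniformOn (E : Set β)) ∂(μ.map H) := by
        rw [hmap, hθ.unif, integral_prod _ Integrable.of_finite]
    _ = ∫ a, (E.card : ℝ)⁻¹ * ∑ e ∈ E, F e a ∂(μ.map H) := by
        simp only [integral_uniformOn_finset E hθ.nonempty]
    _ = ∫ ω, (E.card : ℝ)⁻¹ * ∑ e ∈ E, F e (H ω) ∂μ :=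
        integral_map hH.aemeasurable (measurable_of_finite _).aestronglyMeasurable
    _ = _ := by simp only [hF, H]

end IsUniformDriving

end UniformDriving

/-! ### The averaged update and its linear part -/

section MeanStep

theorem sum_inv_card {β : Type*} {E : Finset β} (hE : E.Nonempty) :
    ∑ _e ∈ E, (E.card : ℝ)⁻¹ = 1 := by
  rw [Finset.sum_const, nsmul_eq_mul, mul_inv_cancel₀]
  exact_mod_cast hE.card_pos.ne'

variable {V : Type*} [Fintype V] [DecidableEq V]

/-- The average of the updates over all edges. -/
noncomputable def meanStep (E : Finset (V × V)) (W : Matrix V V ℝ) (v x : V → ℝ) : V → ℝ :=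
  ∑ e ∈ E, (E.card : ℝ)⁻¹ • gossipStep E W v e x

/-- The linear part of the averaged update. -/
noncomputable def meanMatrix (E : Finset (V × V)) (W : Matrix V V ℝ) : Matrix V V ℝ :=
  1 - (E.card : ℝ)⁻¹ • (1 - sensitivity W * W)

theorem meanStep_apply (E : Finset (V × V)) (W : Matrix V V ℝ) (v x : V → ℝ) (i : V) :
    meanStep E W v x i = (E.card : ℝ)⁻¹ * ∑ e ∈ E, gossipStep E W v e x i := by
  simp [meanStep, Finset.mul_sum]

variable {E : Finset (V × V)} {W : Matrix V V ℝ}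

namespace IsAdaptedStochastic

theorem meanStep_sub_apply (hW : IsAdaptedStochastic E W) (hE : E.Nonempty) (v x : V → ℝ)
    (i : V) :
    meanStep E W v x i - x i = (E.card : ℝ)⁻¹
      * (((1 - sensitivity W) *ᵥ v) i - ((1 - sensitivity W * W) *ᵥ x) i) := by
  have hc : (E.card : ℝ) ≠ 0 := by exact_mod_cast hE.card_pos.ne'
  rw [← hW.sum_gossipStep_sub, Finset.sum_sub_distrib, Finset.sum_const, nsmul_eq_mul,
    meanStep_apply]
  field_simp

theorem abs_meanStep_le (hW : IsAdaptedStochastic E W) (hE : E.Nonempty) {v x : V → ℝ} {C : ℝ}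
    (hv : ∀ i, |v i| ≤ C) (hx : ∀ i, |x i| ≤ C) (i : V) : |meanStep E W v x i| ≤ C := by
  rw [meanStep_apply, Finset.mul_sum]
  calc |∑ e ∈ E, (E.card : ℝ)⁻¹ * gossipStep E W v e x i|
      ≤ ∑ e ∈ E, |(E.card : ℝ)⁻¹ * gossipStep E W v e x i| := Finset.abs_sum_le_sum_abs _ _
    _ ≤ ∑ _e ∈ E, (E.card : ℝ)⁻¹ * C := by
        refine Finset.sum_le_sum fun e he => ?_
        rw [abs_mul, abs_of_nonneg (by positivity : (0 : ℝ) ≤ (E.card : ℝ)⁻¹)]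
        exact mul_le_mul_of_nonneg_left (hW.abs_gossipStep_le he hv hx i) (by positivity)
    _ = C := by rw [← Finset.sum_mul, sum_inv_card hE, one_mul]

/-- Such a z is a fixed point of the affine averaged update; centring at it leaves only the linear
part. -/
theorem meanStep_sub_fixed (hW : IsAdaptedStochastic E W) (hE : E.Nonempty) {v z : V → ℝ}
    (hz : (1 - sensitivity W * W) *ᵥ z = (1 - sensitivity W) *ᵥ v) (x : V → ℝ) :
    meanStep E W v x - z = meanMatrix E W *ᵥ (x - z) := by
  funext i
  have h := hW.meanStep_sub_apply hE v x i
  rw [← hz] at h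
  simp only [meanMatrix, Matrix.sub_mulVec, Matrix.smul_mulVec, Matrix.mulVec_sub,
    Matrix.one_mulVec, Pi.sub_apply, Pi.smul_apply, smul_eq_mul] at h ⊢
  linarith

end IsAdaptedStochastic

theorem mulVec_limitOpinion (hdet : IsUnit (1 - sensitivity W * W).det) (v : V → ℝ) :
    (1 - sensitivity W * W) *ᵥ limitOpinion W v = (1 - sensitivity W) *ᵥ v := by
  rw [limitOpinion, Matrix.mulVec_mulVec, Matrix.mul_nonsing_inv _ hdet, Matrix.one_mulVec]

end MeanStep

/-! ### Convergence of the time averages -/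

section TimeAverage

theorem abs_timeAverage_le {V Ω : Type*} {x : ℕ → Ω → V → ℝ} {C : ℝ} (hC : 0 ≤ C) {ω : Ω}
    (hx : ∀ k i, |x k ω i| ≤ C) (k : ℕ) (i : V) : |timeAverage x k ω i| ≤ C := by
  simp only [timeAverage, Pi.smul_apply, Finset.sum_apply, smul_eq_mul, abs_mul]
  have h : |∑ l ∈ Finset.range k, x l ω i| ≤ k * C :=
    (Finset.abs_sum_le_sum_abs _ _).trans
      ((Finset.sum_le_sum fun l _ => hx l i).trans_eq (by simp))
  rcases eq_or_ne k 0 with rfl | hk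
  -- The average of no terms is 0, which is why `hC` is required.
  · simpa using hC
  · have hk' : (0 : ℝ) < k := by exact_mod_cast Nat.pos_of_ne_zero hk
    rw [abs_of_nonneg (by positivity : (0 : ℝ) ≤ 1 / k)]
    calc 1 / (k : ℝ) * _ ≤ 1 / (k : ℝ) * (k * C) := mul_le_mul_of_nonneg_left h (by positivity)
      _ = C := by field_simp

variable {V Ω : Type*} [Fintype V] [DecidableEq V] {E : Finset (V × V)} {W : Matrix V V ℝ}
  {θ : ℕ → Ω → V × V}

theorem determinedByPast_gossipProcess (E : Finset (V × V)) (W : Matrix V V ℝ) (v : V → ℝ)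
    (θ : ℕ → Ω → V × V) (k : ℕ) : DeterminedByPast θ k (gossipProcess E W v θ k) := by
  induction k with
  | zero => exact fun _ _ _ => rfl
  | succ k ih =>
    intro ω ω' h
    simp only [gossipProcess]
    rw [h k k.lt_succ_self, ih ω ω' fun l hl => h l (hl.trans k.lt_succ_self)]

theorem determinedByPast_timeAverage (E : Finset (V × V)) (W : Matrix V V ℝ) (v : V → ℝ)
    (θ : ℕ → Ω → V × V) (k : ℕ) :
    DeterminedByPast θ k (timeAverage (gossipProcess E W v θ) k) := by
  intro ω ω' h
  simp only [timeAverage]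
  congr 1
  refine Finset.sum_congr rfl fun l hl => ?_
  exact (determinedByPast_gossipProcess E W v θ l).mono (Finset.mem_range.1 hl).le ω ω' h

theorem IsAdaptedStochastic.abs_gossipProcess_le (hW : IsAdaptedStochastic E W) {v : V → ℝ}
    {C : ℝ} (hv : ∀ i, |v i| ≤ C) {ω : Ω} (hω : ∀ k, θ k ω ∈ E) (k : ℕ) (i : V) :
    |(gossipProcess E W v θ k ω i)| ≤ C := by
  induction k generalizing i with
  | zero => exact hv i
  | succ k ih => exact hW.abs_gossipStep_le (hω k) hv ih i

/-- The accumulated deviation of the updates from their conditional means. -/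
noncomputable def gossipNoise (E : Finset (V × V)) (W : Matrix V V ℝ) (v : V → ℝ)
    (θ : ℕ → Ω → V × V) (i : V) (k : ℕ) (ω : Ω) : ℝ :=
  ∑ l ∈ Finset.range k, (gossipProcess E W v θ (l + 1) ω i
    - meanStep E W v (gossipProcess E W v θ l ω) i)

theorem gossipNoise_succ_sub (E : Finset (V × V)) (W : Matrix V V ℝ) (v : V → ℝ)
    (θ : ℕ → Ω → V × V) (i : V) (k : ℕ) (ω : Ω) :
    gossipNoise E W v θ i (k + 1) ω - gossipNoise E W v θ i k ω
      = gossipStep E W v (θ k ω) (gossipProcess E W v θ k ω) i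
        - meanStep E W v (gossipProcess E W v θ k ω) i := by
  rw [gossipNoise, gossipNoise, Finset.sum_range_succ, add_sub_cancel_left]
  rfl

theorem determinedByPast_gossipNoise (E : Finset (V × V)) (W : Matrix V V ℝ) (v : V → ℝ)
    (θ : ℕ → Ω → V × V) (i : V) (k : ℕ) : DeterminedByPast θ k (gossipNoise E W v θ i k) := by
  intro ω ω' h
  refine Finset.sum_congr rfl fun l hl => ?_
  have hlk := Finset.mem_range.1 hl
  rw [(determinedByPast_gossipProcess E W v θ l).mono hlk.le ω ω' h,
    (determinedByPast_gossipProcess E W v θ (l + 1)).mono hlk ω ω' h]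

/-- The total increments telescope, while the drifts are affine in the state and so sum to an
expression in the time average. Solving for that average leaves the noise and the two endpoints. -/
theorem IsAdaptedStochastic.mulVec_timeAverage (hW : IsAdaptedStochastic E W)
    (hE : E.Nonempty) (v : V → ℝ) (ω : Ω) {k : ℕ} (hk : k ≠ 0) (i : V) :
    ((1 - sensitivity W * W) *ᵥ timeAverage (gossipProcess E W v θ) k ω) i
      = ((1 - sensitivity W) *ᵥ v) i
        + E.card * (gossipNoise E W v θ i k ω / k + (v i - gossipProcess E W v θ k ω i) / k) := by
  have hc : (E.card : ℝ) ≠ 0 := by exact_mod_cast hE.card_pos.ne'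
  have hk' : (k : ℝ) ≠ 0 := by exact_mod_cast hk
  have hnoise : gossipNoise E W v θ i k ω = gossipProcess E W v θ k ω i - v i
      - (E.card : ℝ)⁻¹ * (k * ((1 - sensitivity W) *ᵥ v) i
        - ∑ l ∈ Finset.range k,
            ((1 - sensitivity W * W) *ᵥ gossipProcess E W v θ l ω) i) := by
    have htel := Finset.sum_range_sub (fun l => gossipProcess E W v θ l ω i) k
    have hmean := Finset.sum_congr rfl fun l (_ : l ∈ Finset.range k) =>
      hW.meanStep_sub_apply hE v (gossipProcess E W v θ l ω) i
    rw [← Finset.mul_sum, Finset.sum_sub_distrib, Finset.sum_sub_distrib, Finset.sum_const,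
      Finset.card_range, nsmul_eq_mul] at hmean
    rw [Finset.sum_sub_distrib] at htel
    rw [gossipNoise, Finset.sum_sub_distrib, ← hmean]
    change _ = gossipProcess E W v θ k ω i - v i at htel
    linarith
  rw [timeAverage, Matrix.mulVec_smul, Matrix.mulVec_sum, Pi.smul_apply, Finset.sum_apply,
    smul_eq_mul, hnoise]
  field_simp
  ring

variable [MeasurableSpace V] [MeasurableSingletonClass V] [MeasurableSpace Ω] {μ : Measure Ω}
  [IsProbabilityMeasure μ]

theorem IsAdaptedStochastic.ae_tendsto_gossipNoise_div (hW : IsAdaptedStochastic E W)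
    (hθ : IsUniformDriving θ E μ) (v : V → ℝ) (i : V) :
    ∀ᵐ ω ∂μ, Tendsto (fun k : ℕ => gossipNoise E W v θ i k ω / k) atTop (𝓝 0) := by
  have hE := hθ.nonempty
  have hc : (E.card : ℝ) ≠ 0 := by exact_mod_cast hE.card_pos.ne'
  -- Both the new state and its conditional mean lie in the sup-norm ball of radius ‖v‖, hence the
  -- constant.
  refine ae_tendsto_div_of_orthogonal (C := ‖v‖ + ‖v‖) (fun ω => by simp [gossipNoise])
    (fun j k => ?_) (fun k => ?_) (fun k => ?_)
  · refine DeterminedByPast.integrable (θ := θ) (k := max j k) (fun ω ω' h => ?_) hθ.measurable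
    rw [(determinedByPast_gossipNoise E W v θ i j).mono (le_max_left j k) ω ω' h,
      (determinedByPast_gossipNoise E W v θ i k).mono (le_max_right j k) ω ω' h]
  · filter_upwards [hθ.ae_forall_mem] with ω hω
    have hv := fun i => norm_le_pi_norm v i
    have hx := hW.abs_gossipProcess_le hv hω
    rw [gossipNoise_succ_sub]
    exact (abs_sub _ _).trans (add_le_add (hx (k + 1) i) (hW.abs_meanStep_le hE hv (hx k) i))
  · simp only [gossipNoise_succ_sub]
    -- With the drawn edge as a free parameter, the other factors depend only on the past; averaging
    -- over E turns the step into `meanStep` and the bracket cancels.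
    rw [hθ.integral_next_eq_average (k := k) (Φ := fun e ω => gossipNoise E W v θ i k ω
      * (gossipStep E W v e (gossipProcess E W v θ k ω) i
        - meanStep E W v (gossipProcess E W v θ k ω) i)) fun e ω ω' h => ?_]
    · refine integral_eq_zero_of_ae (ae_of_all _ fun ω => ?_)
      simp only [← Finset.mul_sum, Finset.sum_sub_distrib, Finset.sum_const, nsmul_eq_mul,
        meanStep_apply, Pi.zero_apply]
      field_simp
      simp
    · simp only
      rw [determinedByPast_gossipNoise E W v θ i k ω ω' h,
        determinedByPast_gossipProcess E W v θ k ω ω' h]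

theorem IsAdaptedStochastic.tendstoAS_timeAverage (hW : IsAdaptedStochastic E W)
    (hθ : IsUniformDriving θ E μ) (hdet : IsUnit (1 - sensitivity W * W).det) (v : V → ℝ) :
    TendstoAS (timeAverage (gossipProcess E W v θ)) μ (limitOpinion W v) := by
  filter_upwards [ae_all_iff.2 fun i => hW.ae_tendsto_gossipNoise_div hθ v i,
    hθ.ae_forall_mem] with ω hω hmem
  have hx := hW.abs_gossipProcess_le (fun i => norm_le_pi_norm v i) hmem
  have hbd : ∀ i, Tendsto (fun k : ℕ => (v i - gossipProcess E W v θ k ω i) / k) atTop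
      (𝓝 0) := by
    intro i
    refine squeeze_zero_norm (a := fun k : ℕ => (‖v‖ + ‖v‖) / k) (fun k => ?_)
      (tendsto_const_div_atTop_nhds_zero_nat _)
    rw [norm_div, Real.norm_natCast]
    exact div_le_div_of_nonneg_right
      ((abs_sub _ _).trans (add_le_add (norm_le_pi_norm v i) (hx k i))) (Nat.cast_nonneg k)
  have hB : Tendsto (fun k => (1 - sensitivity W * W) *ᵥ
      timeAverage (gossipProcess E W v θ) k ω) atTop (𝓝 ((1 - sensitivity W) *ᵥ v)) := by
    refine tendsto_pi_nhds.2 fun i => ?_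
    have := (((hω i).add (hbd i)).const_mul (E.card : ℝ)).const_add
      (((1 - sensitivity W) *ᵥ v) i)
    rw [add_zero, mul_zero, add_zero] at this
    refine this.congr' ?_
    filter_upwards [eventually_ne_atTop 0] with k hk
    exact (hW.mulVec_timeAverage hθ.nonempty v ω hk i).symm
  -- Convergence after applying I - ΛW is pulled back through the continuous inverse.
  have hcont : Continuous fun y : V → ℝ => (1 - sensitivity W * W)⁻¹ *ᵥ y :=
    continuous_const.matrix_mulVec continuous_id
  have := (hcont.tendsto _).comp hB
  refine this.congr fun k => ?_
  simp only [Function.comp_apply]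
  rw [Matrix.mulVec_mulVec, Matrix.nonsing_inv_mul _ hdet, Matrix.one_mulVec]

/-- The averages are almost surely bounded by ‖v‖ in every coordinate, so dominated convergence
upgrades almost sure convergence. -/
theorem IsAdaptedStochastic.tendstoMS_timeAverage (hW : IsAdaptedStochastic E W)
    (hθ : IsUniformDriving θ E μ) {v m : V → ℝ}
    (h : TendstoAS (timeAverage (gossipProcess E W v θ)) μ m) :
    TendstoMS (timeAverage (gossipProcess E W v θ)) μ m := by
  have hint : ∀ k, Integrable
      (fun ω => ‖WithLp.toLp 2 (timeAverage (gossipProcess E W v θ) k ω - m)‖ ^ 2) μ := by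
    intro k
    refine DeterminedByPast.integrable (θ := θ) (k := k) (fun ω ω' h => ?_) hθ.measurable
    rw [determinedByPast_timeAverage E W v θ k ω ω' h]
  have hnorm : ∀ y : V → ℝ, ‖WithLp.toLp 2 y‖ ^ 2 = ∑ i, |y i| ^ 2 := fun y => by
    simp [EuclideanSpace.norm_sq_eq]
  refine ⟨hint, ?_⟩
  have key := tendsto_integral_of_dominated_convergence (μ := μ)
    (F := fun k ω => ‖WithLp.toLp 2 (timeAverage (gossipProcess E W v θ) k ω - m)‖ ^ 2)
    (f := fun _ => 0) (fun _ => ∑ i, (‖v‖ + |m i|) ^ 2)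
    (fun k => (hint k).aestronglyMeasurable) (integrable_const _) (fun k => ?_) ?_
  · simpa using key
  · filter_upwards [hθ.ae_forall_mem] with ω hω
    rw [Real.norm_of_nonneg (by positivity), hnorm]
    refine Finset.sum_le_sum fun i _ => pow_le_pow_left₀ (abs_nonneg _) ?_ 2
    exact (abs_sub _ _).trans (add_le_add (abs_timeAverage_le (norm_nonneg v)
      (hW.abs_gossipProcess_le (fun i => norm_le_pi_norm v i) hω) k i) le_rfl)
  · filter_upwards [h] with ω hω
    have hcont : Continuous fun y : V → ℝ => ‖WithLp.toLp 2 (y - m)‖ ^ 2 := by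
      simp only [hnorm]
      fun_prop
    have := (hcont.tendsto m).comp hω
    simpa [Function.comp_def] using this

end TimeAverage

/-! ### The backward process and its almost sure limit -/

section BackwardIterate

variable {V Ω : Type*} [Fintype V] [DecidableEq V] {E : Finset (V × V)} {W : Matrix V V ℝ}
  {θ : ℕ → Ω → V × V}

/-- The updates along `θ 0, …, θ (k - 1)` composed in reverse order, so that `θ (k - 1)` acts
first. Unlike the forward process, it converges almost surely. -/
noncomputable def backwardIterate (E : Finset (V × V)) (W : Matrix V V ℝ) (v : V → ℝ)
    (θ : ℕ → Ω → V × V) : ℕ → Ω → (V → ℝ) → V → ℝ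
  | 0, _, x => x
  | k + 1, ω, x => backwardIterate E W v θ k ω (gossipStep E W v (θ k ω) x)

theorem determinedByPast_backwardIterate (E : Finset (V × V)) (W : Matrix V V ℝ) (v : V → ℝ)
    (θ : ℕ → Ω → V × V) (k : ℕ) :
    DeterminedByPast θ k (backwardIterate E W v θ k) := by
  induction k with
  | zero => exact fun _ _ _ => rfl
  | succ k ih =>
    intro ω ω' h
    funext x
    simp only [backwardIterate]
    rw [h k k.lt_succ_self, ih ω ω' fun l hl => h l (hl.trans k.lt_succ_self)]

theorem backwardIterate_sub (v w : V → ℝ) (k : ℕ) (ω : Ω) (x y : V → ℝ) :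
    backwardIterate E W v θ k ω x - backwardIterate E W w θ k ω y
      = backwardIterate E W (v - w) θ k ω (x - y) := by
  induction k generalizing x y with
  | zero => rfl
  | succ k ih => simp only [backwardIterate, ih, gossipStep_sub]

theorem backwardIterate_smul (v : V → ℝ) (k : ℕ) (ω : Ω) (c : ℝ) (x : V → ℝ) :
    backwardIterate E W (c • v) θ k ω (c • x) = c • backwardIterate E W v θ k ω x := by
  induction k generalizing x with
  | zero => rfl
  | succ k ih => simp only [backwardIterate, ih, gossipStep_smul]

theorem backwardIterate_sum {ι : Type*} (v : V → ℝ) (k : ℕ) (ω : Ω) (s : Finset ι) (c : ι → ℝ)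
    (hc : ∑ a ∈ s, c a = 1) (x : ι → V → ℝ) :
    backwardIterate E W v θ k ω (∑ a ∈ s, c a • x a)
      = ∑ a ∈ s, c a • backwardIterate E W v θ k ω (x a) := by
  induction k generalizing x with
  | zero => rfl
  | succ k ih => simp only [backwardIterate, gossipStep_sum E W v _ s c hc, ih]

namespace IsAdaptedStochastic

theorem backwardIterate_mono (hW : IsAdaptedStochastic E W) {ω : Ω} (hω : ∀ k, θ k ω ∈ E)
    {v w x y : V → ℝ} (hv : v ≤ w) (hx : x ≤ y) (k : ℕ) :
    backwardIterate E W v θ k ω x ≤ backwardIterate E W w θ k ω y := by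
  induction k generalizing x y with
  | zero => exact hx
  | succ k ih => exact ih (hW.gossipStep_mono (hω k) hv hx)

theorem abs_backwardIterate_le (hW : IsAdaptedStochastic E W) {ω : Ω} (hω : ∀ k, θ k ω ∈ E)
    {v x : V → ℝ} {C : ℝ} (hv : ∀ i, |v i| ≤ C) (hx : ∀ i, |x i| ≤ C) (k : ℕ) (i : V) :
    |backwardIterate E W v θ k ω x i| ≤ C := by
  induction k generalizing x with
  | zero => exact hx i
  | succ k ih => exact ih (hW.abs_gossipStep_le (hω k) hv hx)

/-- For v = 0 the iterate is linear and monotone, so sandwiching x between ±C times the all-ones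
vector suffices. -/
theorem abs_backwardIterate_zero_le (hW : IsAdaptedStochastic E W) {ω : Ω}
    (hω : ∀ k, θ k ω ∈ E) {x : V → ℝ} {C : ℝ} (hx : ∀ i, |x i| ≤ C) (k : ℕ) (i : V) :
    |backwardIterate E W 0 θ k ω x i| ≤ C * backwardIterate E W 0 θ k ω 1 i := by
  have hsmul : ∀ c : ℝ, backwardIterate E W 0 θ k ω (c • 1)
      = c • backwardIterate E W 0 θ k ω 1 := fun c => by
    simpa using backwardIterate_smul (E := E) (W := W) (θ := θ) 0 k ω c 1
  refine abs_le.2 ⟨?_, ?_⟩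
  · have := hW.backwardIterate_mono hω (le_refl 0) (x := (-C) • 1) (y := x)
      (fun i => by simpa using (abs_le.1 (hx i)).1) k i
    rw [hsmul] at this
    simpa using this
  · have := hW.backwardIterate_mono hω (le_refl 0) (x := x) (y := C • 1)
      (fun i => by simpa using (abs_le.1 (hx i)).2) k i
    rw [hsmul] at this
    simpa using this

/-- This is the gain from reversing the order: both iterates share the outer k updates, so
subtracting removes the affine part and leaves their linear part acting on a vector of size at most
2‖v‖. -/
theorem abs_backwardIterate_succ_sub_le (hW : IsAdaptedStochastic E W) {ω : Ω}
    (hω : ∀ k, θ k ω ∈ E) (v : V → ℝ) (k : ℕ) (i : V) :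
    |backwardIterate E W v θ (k + 1) ω v i - backwardIterate E W v θ k ω v i|
      ≤ (‖v‖ + ‖v‖) * backwardIterate E W 0 θ k ω 1 i := by
  have hv := fun i => norm_le_pi_norm v i
  rw [← Pi.sub_apply, backwardIterate, backwardIterate_sub, sub_self]
  exact hW.abs_backwardIterate_zero_le hω (fun j => (abs_sub _ _).trans
    (add_le_add (hW.abs_gossipStep_le (hω k) hv hv j) (hv j))) k i

variable [MeasurableSpace V] [MeasurableSingletonClass V] [MeasurableSpace Ω] {μ : Measure Ω}
  [IsProbabilityMeasure μ]

/-- The newest update is innermost and independent of the outer ones, which are affine; averaging it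
therefore replaces x by its `meanStep`, and induction applies at that point. -/
theorem integral_backwardIterate (hW : IsAdaptedStochastic E W) (hθ : IsUniformDriving θ E μ)
    {v z : V → ℝ} (hz : (1 - sensitivity W * W) *ᵥ z = (1 - sensitivity W) *ᵥ v) (k : ℕ)
    (x : V → ℝ) (i : V) :
    ∫ ω, backwardIterate E W v θ k ω x i ∂μ = z i + (meanMatrix E W ^ k *ᵥ (x - z)) i := by
  induction k generalizing x with
  | zero => simp [backwardIterate]
  | succ k ih =>
    simp only [backwardIterate]
    rw [hθ.integral_next_eq_average (k := k)
      (Φ := fun e ω => backwardIterate E W v θ k ω (gossipStep E W v e x) i)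
      fun e ω ω' h => by
        simp only
        rw [determinedByPast_backwardIterate E W v θ k ω ω' h]]
    rw [pow_succ, ← Matrix.mulVec_mulVec, ← hW.meanStep_sub_fixed hθ.nonempty hz, ← ih]
    refine integral_congr_ae (ae_of_all _ fun ω => ?_)
    simp only
    rw [meanStep, backwardIterate_sum _ _ _ _ _ (sum_inv_card hθ.nonempty)]
    simp [Finset.mul_sum]

theorem integral_backwardIterate_zero (hW : IsAdaptedStochastic E W)
    (hθ : IsUniformDriving θ E μ) (k : ℕ) (x : V → ℝ) (i : V) :
    ∫ ω, backwardIterate E W 0 θ k ω x i ∂μ = (meanMatrix E W ^ k *ᵥ x) i := by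
  rw [hW.integral_backwardIterate hθ (z := 0) (by simp)]
  simp

theorem integrable_backwardIterate (hθ : IsUniformDriving θ E μ) (v x : V → ℝ) (k : ℕ)
    (i : V) : Integrable (fun ω => backwardIterate E W v θ k ω x i) μ :=
  DeterminedByPast.integrable (θ := θ) (k := k) (fun ω ω' h => by
    rw [determinedByPast_backwardIterate E W v θ k ω ω' h]) hθ.measurable

/-- The linear parts of the backward iterates are almost surely summable. -/
theorem ae_summable_backwardIterate_one (hW : IsAdaptedStochastic E W)
    (hθ : IsUniformDriving θ E μ) (hdet : IsUnit (1 - sensitivity W * W).det) (i : V) :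
    ∀ᵐ ω ∂μ, Summable fun k => backwardIterate E W 0 θ k ω 1 i := by
  have hc : (E.card : ℝ) ≠ 0 := by exact_mod_cast hθ.nonempty.card_pos.ne'
  set B := 1 - sensitivity W * W with hB
  have hnonneg : ∀ k j, 0 ≤ᵐ[μ] fun ω => backwardIterate E W 0 θ k ω 1 j := by
    intro k j
    filter_upwards [hθ.ae_forall_mem] with ω hω
    simpa using (abs_nonneg _).trans
      (hW.abs_backwardIterate_zero_le hω (x := 1) (C := 1) (by simp) k j)
  have hle : ∀ k j, 0 ≤ (meanMatrix E W ^ k *ᵥ 1) j := by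
    intro k j
    rw [← hW.integral_backwardIterate_zero hθ]
    exact integral_nonneg_of_ae (hnonneg k j)
  have hle1 : ∀ k j, (meanMatrix E W ^ k *ᵥ 1) j ≤ 1 := by
    intro k j
    rw [← hW.integral_backwardIterate_zero hθ]
    calc ∫ ω, backwardIterate E W 0 θ k ω 1 j ∂μ ≤ ∫ _, (1 : ℝ) ∂μ := by
          refine integral_mono_ae (integrable_backwardIterate hθ _ _ _ _)
            (integrable_const _) ?_
          filter_upwards [hθ.ae_forall_mem] with ω hω
          exact (le_abs_self _).trans
            (hW.abs_backwardIterate_le hω (by simp) (by simp) k j)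
      _ = 1 := by simp
  -- Since 1 minus `meanMatrix` is |E|⁻¹B with B invertible, geometric sums have a closed form. With
  -- the powers applied to the all-ones vector staying in [0, 1], this bounds them uniformly without
  -- any spectral estimate.
  have hgeom : ∀ n, ∑ k ∈ Finset.range n, meanMatrix E W ^ k
      = (E.card : ℝ) • (B⁻¹ * (1 - meanMatrix E W ^ n)) := by
    intro n
    have h1 := mul_neg_geom_sum (meanMatrix E W) n
    rw [← h1, show 1 - meanMatrix E W = (E.card : ℝ)⁻¹ • B by simp [meanMatrix, hB],
      Matrix.smul_mul, Matrix.mul_smul, ← mul_assoc, Matrix.nonsing_inv_mul _ hdet, one_mul,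
      smul_smul, mul_inv_cancel₀ hc, one_smul]
  refine ae_summable_of_sum_integral_le (hnonneg · i)
    (fun k => integrable_backwardIterate hθ _ _ _ _) (c := E.card * ∑ j, |B⁻¹ i j|) fun n => ?_
  simp only [hW.integral_backwardIterate_zero hθ]
  rw [← Finset.sum_apply, ← Matrix.sum_mulVec, hgeom, Matrix.smul_mulVec,
    ← Matrix.mulVec_mulVec, Pi.smul_apply, smul_eq_mul]
  refine mul_le_mul_of_nonneg_left (Finset.sum_le_sum fun j _ => ?_) (Nat.cast_nonneg _)
  refine (le_abs_self _).trans ?_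
  rw [abs_mul]
  refine mul_le_of_le_one_right (abs_nonneg _) ?_
  rw [Matrix.sub_mulVec, Matrix.one_mulVec, Pi.sub_apply, Pi.one_apply]
  exact abs_le.2 ⟨by linarith [hle1 n j], by linarith [hle n j]⟩

/-- The almost sure limit of the backward process. -/
theorem exists_backwardIterate_limit (hW : IsAdaptedStochastic E W)
    (hθ : IsUniformDriving θ E μ) (hdet : IsUnit (1 - sensitivity W * W).det) (v : V → ℝ) :
    ∃ xInf : Ω → V → ℝ, (∀ᵐ ω ∂μ, Tendsto (fun k => backwardIterate E W v θ k ω v) atTop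
      (𝓝 (xInf ω))) ∧ Integrable xInf μ ∧ ∫ ω, xInf ω ∂μ = limitOpinion W v := by
  have hconv : ∀ᵐ ω ∂μ, ∀ i, ∃ y, Tendsto (fun k => backwardIterate E W v θ k ω v i) atTop
      (𝓝 y) := by
    filter_upwards [ae_all_iff.2 fun i => hW.ae_summable_backwardIterate_one hθ hdet i,
      hθ.ae_forall_mem] with ω hs hω i
    have hsum : Summable fun k => backwardIterate E W v θ (k + 1) ω v i
        - backwardIterate E W v θ k ω v i :=
      Summable.of_norm_bounded ((hs i).mul_left (‖v‖ + ‖v‖))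
        fun k => hW.abs_backwardIterate_succ_sub_le hω v k i
    refine ⟨_, (hsum.hasSum.tendsto_sum_nat.const_add
      (backwardIterate E W v θ 0 ω v i)).congr fun k => ?_⟩
    rw [Finset.sum_range_sub (fun k => backwardIterate E W v θ k ω v i)]
    ring
  -- `limUnder` takes a junk value where the limit fails to exist, which is a null set by `hconv`.
  set xInf : Ω → V → ℝ := fun ω i => limUnder atTop fun k => backwardIterate E W v θ k ω v i
    with hxInf
  have hlim : ∀ᵐ ω ∂μ, ∀ i, Tendsto (fun k => backwardIterate E W v θ k ω v i) atTop
      (𝓝 (xInf ω i)) := by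
    filter_upwards [hconv] with ω hω i
    exact tendsto_nhds_limUnder (hω i)
  have hbound : ∀ k i, ∀ᵐ ω ∂μ, ‖backwardIterate E W v θ k ω v i‖ ≤ ‖v‖ := fun k i => by
    filter_upwards [hθ.ae_forall_mem] with ω hω
    exact hW.abs_backwardIterate_le hω (norm_le_pi_norm v) (norm_le_pi_norm v) k i
  have hmeas : ∀ k i, AEStronglyMeasurable (fun ω => backwardIterate E W v θ k ω v i) μ :=
    fun k i => (integrable_backwardIterate hθ v v k i).aestronglyMeasurable
  have hlim_i : ∀ i, ∀ᵐ ω ∂μ, Tendsto (fun k => backwardIterate E W v θ k ω v i) atTop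
      (𝓝 (xInf ω i)) := fun i => hlim.mono fun ω hω => hω i
  have hint : ∀ i, Integrable (fun ω => xInf ω i) μ := by
    intro i
    refine Integrable.of_bound
      (aestronglyMeasurable_of_tendsto_ae atTop (fun k => hmeas k i) (hlim_i i)) ‖v‖ ?_
    filter_upwards [hlim_i i, ae_all_iff.2 fun k => hbound k i] with ω hω hb
    exact le_of_tendsto hω.norm (Eventually.of_forall hb)
  refine ⟨xInf, hlim.mono fun ω hω => tendsto_pi_nhds.2 hω, Integrable.of_eval hint, ?_⟩
  set z := limitOpinion W v with hz
  -- L is the limit of the powers of `meanMatrix` applied to v - z, hence fixed by `meanMatrix`. A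
  -- fixed vector lies in the kernel of I - ΛW, so L = 0.
  set L : V → ℝ := fun i => ∫ ω, xInf ω i ∂μ - z i with hL
  have hpow : Tendsto (fun k => meanMatrix E W ^ k *ᵥ (v - z)) atTop (𝓝 L) := by
    refine tendsto_pi_nhds.2 fun i => ?_
    have := (tendsto_integral_of_dominated_convergence (fun _ => ‖v‖) (fun k => hmeas k i)
      (integrable_const _) (fun k => hbound k i) (hlim_i i)).sub_const (z i)
    refine this.congr fun k => ?_
    rw [hW.integral_backwardIterate hθ (mulVec_limitOpinion hdet v), ← hz, add_sub_cancel_left]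
  have hcont : Continuous fun y : V → ℝ => meanMatrix E W *ᵥ y :=
    continuous_const.matrix_mulVec continuous_id
  have hfix : meanMatrix E W *ᵥ L = L := by
    refine tendsto_nhds_unique ((hcont.tendsto L).comp hpow) ?_
    refine ((tendsto_add_atTop_iff_nat 1).2 hpow).congr fun k => ?_
    rw [pow_succ', ← Matrix.mulVec_mulVec]
    rfl
  have hL0 : L = 0 := by
    have hc : (E.card : ℝ)⁻¹ ≠ 0 := by
      have := hθ.nonempty.card_pos.ne'
      positivity
    rw [meanMatrix, Matrix.sub_mulVec, Matrix.one_mulVec, sub_eq_self, Matrix.smul_mulVec,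
      smul_eq_zero_iff_right hc] at hfix
    exact Matrix.eq_zero_of_mulVec_eq_zero hdet.ne_zero hfix
  funext i
  rw [eval_integral hint]
  exact sub_eq_zero.1 (congrFun hL0 i)

end IsAdaptedStochastic

end BackwardIterate

end GossipOpinion

open GossipOpinion in
theorem theorem4 {V : Type*} [Fintype V] [DecidableEq V]
    [MeasurableSpace V] [MeasurableSingletonClass V]
    (E : Finset (V × V)) (hloop : ∀ i, (i, i) ∈ E)
    (W : Matrix V V ℝ) (hW_nonneg : ∀ i j, 0 ≤ W i j) (hW_sum : ∀ i, ∑ j, W i j = 1)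
    (hW_adapted : ∀ i j, (i, j) ∉ E → W i j = 0)
    (hpath : ∀ l, ∃ i, 0 < W i i ∧ HasPath (assocEdges W) l i)
    (v : V → ℝ)
    {Ω : Type*} [MeasurableSpace Ω] (μ : Measure Ω) [IsProbabilityMeasure μ]
    (θ : ℕ → Ω → V × V) (hθ_meas : ∀ k, Measurable (θ k))
    (hθ_indep : iIndepFun θ μ)
    (hθ_unif : ∀ k, μ.map (θ k) = uniformOn (E : Set (V × V))) :
    IsUnit (1 - sensitivity W * W).det ∧
      ErgodicAS (gossipProcess E W v θ) μ ∧
      ErgodicMS (gossipProcess E W v θ) μ ∧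
      TendstoAS (timeAverage (gossipProcess E W v θ)) μ (limitOpinion W v) ∧
      TendstoMS (timeAverage (gossipProcess E W v θ)) μ (limitOpinion W v) := by
  have hW : IsAdaptedStochastic E W := ⟨hloop, hW_nonneg, hW_sum, hW_adapted⟩
  have hθ : IsUniformDriving θ E μ := ⟨hθ_meas, hθ_indep, hθ_unif⟩
  have hdet := hW.isUnit_det hpath
  have has := hW.tendstoAS_timeAverage hθ hdet v
  have hms := hW.tendstoMS_timeAverage hθ has
  -- Ergodicity as defined needs only the integrability and the mean of the backward limit.
  obtain ⟨xInf, -, hint, hexp⟩ := hW.exists_backwardIterate_limit hθ hdet v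
  exact ⟨hdet, ⟨xInf, hint, hexp ▸ has⟩, ⟨xInf, hint, hexp ▸ hms⟩, has, hms⟩
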